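/- Let $G=(V,E)$ be a finite simple graph (not necessarily bipartite), let $W\ge 1$ be an integer, and let every edge $uv\in E$ carry an integer weight $w(u,v)\in\{1,\dots,W\}$. For a subgraph $H$ of $G$ and $v\in V$ let $\operatorname{wdeg}_H(v)=\sum_{u\,:\,uv\in H}w(u,v)$ (which is $0$ if $v$ has no neighbour in $H$). For integers $\beta\ge 3$ and $\beta^-\le\beta-2$, a subgraph $H$ of $G$ is called a $(\beta,\beta^-)$-$w$-EDCS of $G$ if (i) $\operatorname{wdeg}_H(u)+\operatorname{wdeg}_H(v)\le\beta\, w(u,v)$ for every edge $uv$ of $H$, and (ii) $\operatorname{wdeg}_H(u)+\operatorname{wdeg}_H(v)\ge\beta^-\, w(u,v)$ for every edge $uv$ of $G$ that is not an edge of $H$. The weight $w(M)$ of a matching $M$ is the sum of the weights of its edges. **Theorem.** Let $0<\varepsilon<1/2$ and $\lambda=\frac{\varepsilon}{100W}$, and let $\beta\ge\beta^-+2$ be integers such that $$\frac{\beta}{\log\beta}\ \ge\ 2W^2\lambda^{-2}\qquad\text{and}\qquad \beta^-\ \ge\ (1-\lambda)\,\beta ,$$ where $\log$ is the natural logarithm.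 Then every $(\beta,\beta^-)$-$w$-EDCS $H$ of $G$ contains a matching $M_H$ such that $$\Bigl(2-\frac{1}{2W}+\varepsilon\Bigr)\, w(M_H)\ \ge\ w(M_G),$$ where $M_G$ is a maximum weight matching of $G$. -/

import Mathlib

section WEDCS

variable {V : Type*} [Fintype V] {G : SimpleGraph V}

open Classical in
/-- The weighted degree of `v` in the subgraph `H`: the sum of `w(u, v)` over the neighbours `u`
of `v` in `H`. -/
noncomputable def wdeg (w : Sym2 V → ℕ) (H : G.Subgraph) (v : V) : ℕ :=
  ∑ u with H.Adj v u, w s(v, u)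

open Classical in
/-- The total weight of the edges of a subgraph `M`. -/
noncomputable def totalWeight (w : Sym2 V → ℕ) (M : G.Subgraph) : ℕ :=
  ∑ e with e ∈ M.edgeSet, w e

/-- `H` is a `(β, βm)`-`w`-EDCS (weighted edge-degree constrained subgraph) of `G`, for integer
parameters `β ≥ 3` and `βm ≤ β - 2`. -/
structure IsWEDCS (w : Sym2 V → ℕ) (β βm : ℤ) (H : G.Subgraph) : Prop where
  three_le : 3 ≤ β
  le_sub_two : βm ≤ β - 2
  /-- every edge of `H` has weighted edge-degree at most `β` times its weight -/
  upper : ∀ u v : V, H.Adj u v →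
    (wdeg w H u : ℤ) + (wdeg w H v : ℤ) ≤ β * (w s(u, v) : ℤ)
  /-- every edge of `G` that is not in `H` has weighted edge-degree at least `βm` times its
  weight -/
  lower : ∀ u v : V, G.Adj u v → ¬ H.Adj u v →
    βm * (w s(u, v) : ℤ) ≤ (wdeg w H u : ℤ) + (wdeg w H v : ℤ)

/-- `M` is a maximum weight matching among the matchings contained in the subgraph `H`. For a
maximum weight matching of the whole graph `G`, take `H = ⊤`. -/
structure IsMaxWeightMatching (w : Sym2 V → ℕ) (H M : G.Subgraph) : Prop where
  le : M ≤ H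
  isMatching : M.IsMatching
  max : ∀ N : G.Subgraph, N ≤ H → N.IsMatching → totalWeight w N ≤ totalWeight w M

/-- Maximum weight matchings exist. -/
theorem exists_isMaxWeightMatching (w : Sym2 V → ℕ) (H : G.Subgraph) :
    ∃ M : G.Subgraph, IsMaxWeightMatching w H M := by
  obtain ⟨M, ⟨hM, hM'⟩, hmax⟩ := Set.exists_max_image
    {M : G.Subgraph | M ≤ H ∧ M.IsMatching} (totalWeight w) (Set.toFinite _)
    ⟨⊥, bot_le, fun v hv => by simp at hv⟩
  exact ⟨M, hM, hM', fun N h h' => hmax N ⟨h, h'⟩⟩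

end WEDCS

/-! ### Weighted handshake lemma -/

section DoubleCounting

/-! Let `M` be a maximum weight matching of `G`. Split the vertices at random so that the ends of
each `M`-edge lie on opposite sides, and keep the crossing edges of `H`. By Hoeffding's inequality
nearly all large degrees are nearly halved. Deleting the edges at the bad vertices leaves a
bipartite `K` whose edges satisfy the upper constraint for roughly `β / 2`; the lower one survives
on `M`-edges outside `K` that avoid a small set `Z` (`exists_bipartite_halving`).

Egerváry's theorem gives a matching in `K` of weight `∑ y`, where `y` is an integral cover of `K`.
If `Δ` is the total amount by which `y` fails to cover the `M`-edges off `Z`, then `w(M) ≤ ∑ y + Δ +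
W |Z|`, so the ratio follows once `Δ` is essentially at most `(1 - 1/(2W)) ∑ y` (`deficiency_le`).

Let `a` be the degrees in `K` divided by about `β / 2`. An uncovered `M`-edge off `Z` is not in `K`,
so there `a` exceeds `y` by nearly the deficiency. Along `K`-edges `a u + a v ≤ w ≤ y u + y v`, so a
vertex with surplus `α = a - y > 0` sends its degree only to vertices `z` with `a z ≤ y z - α`. This
forces `∑ y` to be large. The gain `1/(2W)` uses integrality: each deficiency is at least 1, so by
Cauchy–Schwarz `∑ α²` is at least about half of `∑ α`. -/

open Classical in
/-- The weighted degrees of a subgraph add up to twice its total weight. -/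
theorem sum_wdeg {V : Type*} [Fintype V] {G : SimpleGraph V} (w : Sym2 V → ℕ) (H : G.Subgraph) :
    ∑ v, wdeg w H v = 2 * totalWeight w H := by
  unfold wdeg totalWeight
  have h1 : ∑ v, ∑ u with H.Adj v u, w s(v, u)
      = ∑ p : V × V with H.Adj p.1 p.2, w s(p.1, p.2) := by
    rw [Finset.sum_filter, Fintype.sum_prod_type]
    simp only [Finset.sum_filter]
  rw [h1, Finset.mul_sum,
    ← Finset.sum_fiberwise_of_maps_to (t := Finset.univ.filter (· ∈ H.edgeSet))
      (g := fun p : V × V => s(p.1, p.2))]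
  · refine Finset.sum_congr rfl fun e he => ?_
    induction e with
    | _ a b =>
    have hab : H.Adj a b := by simpa using he
    have : (Finset.univ.filter fun p : V × V => H.Adj p.1 p.2).filter
        (fun p => s(p.1, p.2) = s(a, b)) = {(a, b), (b, a)} := by
      ext ⟨p, q⟩
      simp only [Finset.mem_filter, Finset.mem_univ, true_and, Sym2.eq_iff, Finset.mem_insert,
        Finset.mem_singleton, Prod.mk.injEq]
      constructor
      · exact fun h => h.2
      · rintro (⟨rfl, rfl⟩ | ⟨rfl, rfl⟩)
        · exact ⟨hab, Or.inl ⟨rfl, rfl⟩⟩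
        · exact ⟨hab.symm, Or.inr ⟨rfl, rfl⟩⟩
    rw [this, Finset.sum_pair (by simp [hab.ne]), Sym2.eq_swap (a := b), two_mul]
  · intro p hp
    simpa using hp

end DoubleCounting

/-! ### Egerváry's theorem by Hall and Schröder–Bernstein -/

section Egervary

variable {V : Type*} [Fintype V]

/-- In a bipartite graph, a natural-valued weighted vertex cover of minimum total size admits a
matching of tight edges which saturates every vertex of positive value on a given side. -/
theorem exists_injOn_tight_of_min_cover (K : SimpleGraph V) (side : V → Bool)
    (hside : ∀ u v, K.Adj u v → side u ≠ side v) (w : Sym2 V → ℕ) (y : V → ℕ)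
    (hy : ∀ u v, K.Adj u v → w s(u, v) ≤ y u + y v)
    (hmin : ∀ z : V → ℕ, (∀ u v, K.Adj u v → w s(u, v) ≤ z u + z v) → ∑ v, y v ≤ ∑ v, z v)
    (b : Bool) :
    ∃ f : V → V, Set.InjOn f {v | side v = b ∧ 0 < y v} ∧
      ∀ v, side v = b → 0 < y v → K.Adj v (f v) ∧ w s(v, f v) = y v + y (f v) := by
  classical
  let t : {v // side v = b ∧ 0 < y v} → Finset V :=
    fun v => Finset.univ.filter fun u => K.Adj v u ∧ w s(v.1, u) = y v + y u
  have hall : ∀ s : Finset {v // side v = b ∧ 0 < y v}, s.card ≤ (s.biUnion t).card := by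
    intro s
    by_contra! hlt
    let S : Finset V := s.map (Function.Embedding.subtype _)
    let N : Finset V := s.biUnion t
    have hS : ∀ v ∈ S, side v = b ∧ 0 < y v := by
      intro v hv
      obtain ⟨a, -, rfl⟩ := Finset.mem_map.1 hv
      exact a.2
    have hN : ∀ v ∈ N, side v ≠ b := by
      intro v hv
      obtain ⟨a, -, h⟩ := Finset.mem_biUnion.1 hv
      have := hside _ _ (Finset.mem_filter.1 h).2.1
      rw [a.2.1] at this
      exact this.symm
    have hSN : ∀ u v, u ∈ S → K.Adj u v → w s(u, v) = y u + y v → v ∈ N := by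
      intro u v hu h1 h2
      obtain ⟨a, ha, rfl⟩ := Finset.mem_map.1 hu
      exact Finset.mem_biUnion.2 ⟨a, ha, Finset.mem_filter.2 ⟨Finset.mem_univ _, h1, h2⟩⟩
    -- A Hall violator `S` would give a cheaper cover: `y` is positive on `S`, and an edge from `S`
    -- leaving `N` is not tight, hence has integral slack at least 1.
    let z : V → ℕ := fun v => if v ∈ S then y v - 1 else if v ∈ N then y v + 1 else y v
    have key : ∀ u v, K.Adj u v → u ∈ S → w s(u, v) ≤ z u + z v := by
      intro u v huv hu
      have hv : v ∉ S := fun hv => hside _ _ huv ((hS u hu).1.trans (hS v hv).1.symm)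
      have h0 := (hS u hu).2
      have h1 := hy u v huv
      by_cases hvN : v ∈ N
      · simp only [z, hu, hv, hvN, if_true, if_false]; omega
      · have : w s(u, v) ≠ y u + y v := fun h => hvN (hSN u v hu huv h)
        simp only [z, hu, hv, hvN, if_true, if_false]; omega
    have hz : ∀ u v, K.Adj u v → w s(u, v) ≤ z u + z v := by
      intro u v huv
      by_cases hu : u ∈ S
      · exact key u v huv hu
      by_cases hv : v ∈ S
      · rw [Sym2.eq_swap, add_comm]; exact key v u huv.symm hv
      · have h1 := hy u v huv
        simp only [z, hu, hv, if_false]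
        split_ifs <;> omega
    have h2 := hmin z hz
    have h3 : ∑ v, z v + S.card = ∑ v, y v + N.card := by
      have hcard : ∀ T : Finset V, T.card = ∑ v, if v ∈ T then 1 else 0 := by simp
      rw [hcard S, hcard N, ← Finset.sum_add_distrib, ← Finset.sum_add_distrib]
      refine Finset.sum_congr rfl fun v _ => ?_
      by_cases hv : v ∈ S
      · have h0 := hS v hv
        have : v ∉ N := fun h => hN v h h0.1
        simp only [z, hv, this, if_true, if_false]; omega
      · by_cases hvN : v ∈ N <;> simp [z, hv, hvN]
    have h4 : S.card = s.card := Finset.card_map _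
    change N.card < _ at hlt
    omega
  obtain ⟨f, hf, hft⟩ := (Finset.all_card_le_biUnion_card_iff_exists_injective t).1 hall
  refine ⟨fun v => if h : side v = b ∧ 0 < y v then f ⟨v, h⟩ else v, ?_, ?_⟩
  · intro u hu v hv huv
    have hu' : side u = b ∧ 0 < y u := hu
    have hv' : side v = b ∧ 0 < y v := hv
    simp only [hu', hv', and_self, dite_true] at huv
    simpa using hf huv
  · intro v h1 h2
    have := (Finset.mem_filter.1 (hft ⟨v, h1, h2⟩)).2
    simpa [h1, h2] using this

/-- **Egerváry's theorem**: in an edge-weighted bipartite graph there are a natural-valued weighted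
vertex cover `y` and a matching of tight edges which saturates the support of `y`. -/
theorem exists_cover_and_tight_matching (K : SimpleGraph V) (side : V → Bool)
    (hside : ∀ u v, K.Adj u v → side u ≠ side v) (w : Sym2 V → ℕ) :
    ∃ (y : V → ℕ) (M : V → V → Prop), (∀ u v, K.Adj u v → w s(u, v) ≤ y u + y v) ∧
      (∀ u v, M u v → M v u) ∧ (∀ u v v', M u v → M u v' → v = v') ∧
      (∀ u v, M u v → K.Adj u v ∧ w s(u, v) = y u + y v) ∧
      (∀ v, 0 < y v → ∃ u, M v u) := by
  classical
  obtain ⟨y, hy, hmin⟩ : ∃ y : V → ℕ, (∀ u v, K.Adj u v → w s(u, v) ≤ y u + y v) ∧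
      ∀ z : V → ℕ, (∀ u v, K.Adj u v → w s(u, v) ≤ z u + z v) → ∑ v, y v ≤ ∑ v, z v := by
    let S : Set (V → ℕ) := {y | ∀ u v, K.Adj u v → w s(u, v) ≤ y u + y v}
    have hne : S.Nonempty := by
      refine ⟨fun u => ∑ v, w s(u, v), fun u v _ => ?_⟩
      exact (Finset.single_le_sum (f := fun v => w s(u, v)) (fun _ _ => Nat.zero_le _)
        (Finset.mem_univ v)).trans (Nat.le_add_right _ _)
    exact ⟨Function.argminOn (fun y : V → ℕ => ∑ v, y v) S hne,
      Function.argminOn_mem (fun y : V → ℕ => ∑ v, y v) S hne,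
      fun z hz => Function.argminOn_le (fun y : V → ℕ => ∑ v, y v) S (a := z) hz⟩
  obtain ⟨f, hf, hft⟩ := exists_injOn_tight_of_min_cover K side hside w y hy hmin true
  obtain ⟨g, hg, hgt⟩ := exists_injOn_tight_of_min_cover K side hside w y hy hmin false
  set A : Set V := {v | side v = true ∧ 0 < y v} with hA
  set B : Set V := {v | side v = false ∧ 0 < y v} with hB
  -- Schröder–Bernstein: at a fixed point `C`, using `f` on `C` and `g` on `B \ f '' C` gives a
  -- single matching saturating both `A` and `B`.
  let Φ : Set V →o Set V := ⟨fun C => A \ g '' (B \ f '' C), fun C C' h =>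
    Set.sdiff_subset_sdiff_right (Set.image_mono
      (Set.sdiff_subset_sdiff_right (Set.image_mono h)))⟩
  let C : Set V := OrderHom.lfp Φ
  have hC : A \ g '' (B \ f '' C) = C := Φ.map_lfp
  have hCA : C ⊆ A := by rw [← hC]; exact Set.sdiff_subset
  have hCg : ∀ v ∈ B, v ∉ f '' C → g v ∉ C := by
    intro v hv hv' h
    rw [← hC] at h
    exact h.2 ⟨v, ⟨hv, hv'⟩, rfl⟩
  have hfs : ∀ v ∈ C, side (f v) = false := by
    intro v hv
    have := hside _ _ (hft v (hCA hv).1 (hCA hv).2).1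
    rw [(hCA hv).1] at this
    simpa using this.symm
  have hgs : ∀ v ∈ B, side (g v) = true := by
    intro v hv
    have := hside _ _ (hgt v hv.1 hv.2).1
    rw [hv.1] at this
    simpa using this.symm
  let R : V → V → Prop := fun a b => (a ∈ C ∧ b = f a) ∨ (b ∈ B ∧ b ∉ f '' C ∧ a = g b)
  have hRs : ∀ a b, R a b → side a = true ∧ side b = false := by
    rintro a b (⟨h, rfl⟩ | ⟨h, -, rfl⟩)
    · exact ⟨(hCA h).1, hfs a h⟩
    · exact ⟨hgs b h, h.1⟩
  have hR1 : ∀ a b b', R a b → R a b' → b = b' := by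
    rintro a b b' (⟨h, rfl⟩ | ⟨h, h', rfl⟩) (⟨k, rfl⟩ | ⟨k, k', e⟩)
    · rfl
    · exact absurd (e ▸ h) (hCg b' k k')
    · exact absurd k (hCg b h h')
    · exact hg h k e
  have hR2 : ∀ a a' b, R a b → R a' b → a = a' := by
    rintro a a' b (⟨h, rfl⟩ | ⟨h, h', rfl⟩) (⟨k, e⟩ | ⟨k, k', rfl⟩)
    · exact hf (hCA h) (hCA k) e
    · exact absurd ⟨a, h, rfl⟩ k'
    · exact absurd ⟨a', k, e.symm⟩ h'
    · rfl
  have hRt : ∀ a b, R a b → K.Adj a b ∧ w s(a, b) = y a + y b := by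
    rintro a b (⟨h, rfl⟩ | ⟨h, -, rfl⟩)
    · exact hft a (hCA h).1 (hCA h).2
    · have := hgt b h.1 h.2
      refine ⟨this.1.symm, ?_⟩
      rw [Sym2.eq_swap, this.2, add_comm]
  refine ⟨y, fun a b => R a b ∨ R b a, hy, fun a b h => h.symm, ?_, ?_, ?_⟩
  · rintro a b b' (h | h) (k | k)
    · exact hR1 a b b' h k
    · simpa [(hRs _ _ h).1] using (hRs _ _ k).2
    · simpa [(hRs _ _ k).1] using (hRs _ _ h).2
    · exact hR2 b b' a h k
  · rintro a b (h | h)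
    · exact hRt a b h
    · have := hRt b a h
      refine ⟨this.1.symm, ?_⟩
      rw [Sym2.eq_swap, this.2, add_comm]
  · intro v hv
    cases hs : side v with
    | true =>
      by_cases hvC : v ∈ C
      · exact ⟨f v, Or.inl (Or.inl ⟨hvC, rfl⟩)⟩
      · rw [← hC] at hvC
        have hvA : v ∈ A := ⟨hs, hv⟩
        have : v ∈ g '' (B \ f '' C) := by
          by_contra h
          exact hvC ⟨hvA, h⟩
        obtain ⟨b, hb, rfl⟩ := this
        exact ⟨b, Or.inl (Or.inr ⟨hb.1, hb.2, rfl⟩)⟩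
    | false =>
      by_cases hvC : v ∈ f '' C
      · obtain ⟨a, ha, rfl⟩ := hvC
        exact ⟨a, Or.inr (Or.inl ⟨ha, rfl⟩)⟩
      · exact ⟨g v, Or.inr (Or.inr ⟨⟨hs, hv⟩, hvC, rfl⟩)⟩

end Egervary

/-! ### Hoeffding's inequality by counting sign vectors -/

section RandomSigns

/-- The sign `1` or `-1` attached to a Boolean. -/
def boolSign (b : Bool) : ℝ := if b then 1 else -1

theorem abs_boolSign (b : Bool) : |boolSign b| = 1 := by cases b <;> simp [boolSign]

/-- The moment generating function factors over independent signs; combined with `cosh x ≤ exp (x² /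
2)` it yields the Chernoff bound. -/
theorem sum_exp_signs {ι : Type*} [Fintype ι] [DecidableEq ι] (c : ι → ℝ) :
    ∑ σ : ι → Bool, Real.exp (∑ i, c i * boolSign (σ i)) = ∏ i, (2 * Real.cosh (c i)) := by
  have : ∀ i, 2 * Real.cosh (c i) = ∑ b : Bool, Real.exp (c i * boolSign b) := by
    intro i
    rw [Fintype.sum_bool, Real.cosh_eq]
    simp only [boolSign, if_true, mul_one, mul_neg, Bool.false_eq_true, if_false]
    ring
  simp only [this, Real.exp_sum]
  rw [Finset.prod_univ_sum, Fintype.piFinset_univ]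

/-- Hoeffding's inequality for sign vectors, in counting form, upper tail. -/
theorem card_signs_le {ι : Type*} [Fintype ι] [DecidableEq ι] (c : ι → ℝ) (S T : ℝ) (hS : 0 < S)
    (hT : 0 ≤ T) (hc : ∑ i, c i ^ 2 ≤ S) :
    ((Finset.univ.filter fun σ : ι → Bool => T ≤ ∑ i, c i * boolSign (σ i)).card : ℝ)
      ≤ Fintype.card (ι → Bool) * Real.exp (-(T ^ 2 / (2 * S))) := by
  -- This choice minimises the Chernoff exponent `l² S / 2 - l T`.
  set l := T / S with hl
  have hl0 : 0 ≤ l := by positivity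
  have h1 : ∑ σ : ι → Bool, Real.exp (∑ i, (l * c i) * boolSign (σ i))
      ≤ Fintype.card (ι → Bool) * Real.exp (l ^ 2 * S / 2) := by
    rw [sum_exp_signs, Finset.prod_mul_distrib]
    have h2 : ∏ i, Real.cosh (l * c i) ≤ Real.exp (l ^ 2 * S / 2) := by
      calc ∏ i, Real.cosh (l * c i) ≤ ∏ i, Real.exp ((l * c i) ^ 2 / 2) :=
            Finset.prod_le_prod (fun i _ => (Real.cosh_pos _).le)
              fun i _ => Real.cosh_le_exp_half_sq _
        _ = Real.exp (l ^ 2 * (∑ i, c i ^ 2) / 2) := by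
            rw [← Real.exp_sum, ← Finset.sum_div, Finset.mul_sum]
            simp only [mul_pow]
        _ ≤ _ := by gcongr
    have h3 : ∏ _i : ι, (2 : ℝ) = Fintype.card (ι → Bool) := by simp
    rw [h3]
    gcongr
  have h4 : ((Finset.univ.filter fun σ : ι → Bool => T ≤ ∑ i, c i * boolSign (σ i)).card : ℝ)
      * Real.exp (l * T) ≤ ∑ σ : ι → Bool, Real.exp (∑ i, (l * c i) * boolSign (σ i)) := by
    rw [← nsmul_eq_mul, ← Finset.sum_const]
    refine (Finset.sum_le_sum fun σ hσ => ?_).trans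
      (Finset.sum_le_sum_of_subset_of_nonneg (Finset.filter_subset _ _)
        fun σ _ _ => (Real.exp_pos _).le)
    rw [Real.exp_le_exp]
    simp only [mul_assoc, ← Finset.mul_sum]
    exact mul_le_mul_of_nonneg_left (Finset.mem_filter.1 hσ).2 hl0
  have h5 : Real.exp (l ^ 2 * S / 2) = Real.exp (-(T ^ 2 / (2 * S))) * Real.exp (l * T) := by
    rw [← Real.exp_add]
    congr 1
    rw [hl]
    field_simp
    ring
  have h6 := h4.trans h1
  rw [h5, ← mul_assoc] at h6
  exact le_of_mul_le_mul_right h6 (Real.exp_pos _)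

/-- Hoeffding's inequality for sign vectors, in counting form, both tails. -/
theorem card_abs_signs_le {ι : Type*} [Fintype ι] [DecidableEq ι] (c : ι → ℝ) (S T : ℝ)
    (hS : 0 < S) (hT : 0 ≤ T) (hc : ∑ i, c i ^ 2 ≤ S) :
    ((Finset.univ.filter fun σ : ι → Bool => T ≤ |∑ i, c i * boolSign (σ i)|).card : ℝ)
      ≤ Fintype.card (ι → Bool) * (2 * Real.exp (-(T ^ 2 / (2 * S)))) := by
  have h1 := card_signs_le c S T hS hT hc
  have h2 := card_signs_le (fun i => - c i) S T hS hT (by simpa using hc)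
  have h3 : (Finset.univ.filter fun σ : ι → Bool => T ≤ |∑ i, c i * boolSign (σ i)|) ⊆
      (Finset.univ.filter fun σ : ι → Bool => T ≤ ∑ i, c i * boolSign (σ i)) ∪
      (Finset.univ.filter fun σ : ι → Bool => T ≤ ∑ i, (- c i) * boolSign (σ i)) := by
    intro σ
    simp only [Finset.mem_filter, Finset.mem_union, Finset.mem_univ, true_and, neg_mul,
      Finset.sum_neg_distrib]
    exact le_abs.1
  have h4 := Nat.cast_le (α := ℝ).2 ((Finset.card_le_card h3).trans (Finset.card_union_le _ _))
  push_cast at h4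
  linarith

end RandomSigns

/-! ### Random bipartition separating matched pairs -/

section Bipartition

variable {V : Type*} [Fintype V]

/-- Sides can be chosen so that `v` and `μ v ≠ v` are separated and all but few of the vertices of
weighted degree at least `t` have an almost evenly split neighbourhood. -/
theorem exists_balanced_sides (q : V → V → ℝ) (W D t : ℝ) (hW : 0 < W) (hD : 0 < D) (ht : 0 < t)
    (hq0 : ∀ u v, 0 ≤ q u v) (hqW : ∀ u v, q u v ≤ W) (hqD : ∀ v, ∑ u, q v u ≤ D)
    (μ : V → V) (hμ : ∀ v, μ (μ v) = v) :
    ∃ s : V → Bool, (∀ v, μ v ≠ v → s (μ v) ≠ s v) ∧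
      ((Finset.univ.filter fun v => t ≤ |∑ u, q v u * boolSign (s u)|).card : ℝ)
        ≤ (Finset.univ.filter fun v => t ≤ ∑ u, q v u).card * (2 * Real.exp (-(t ^ 2 / (4 * W * D)))) := by
  classical
  let e := Fintype.equivFin V
  -- A fixed orientation giving the two members of a pair opposite values. One coin per pair,
  -- indexed by `r`, then flips the whole pair.
  let η : V → Bool := fun v => decide (e v ≤ e (μ v))
  have hη : ∀ v, μ v ≠ v → η (μ v) = !η v := by
    intro v hv
    have : e (μ v) ≠ e v := fun h => hv (e.injective h)
    simp only [η, hμ]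
    rcases lt_or_gt_of_ne this with h | h
    · simp [h.le, not_le.2 h]
    · simp [h.le, not_le.2 h]
  let r : V → Sym2 V := fun v => s(v, μ v)
  have hr : ∀ v, r (μ v) = r v := by
    intro v
    simp only [r, hμ]
    exact Sym2.eq_swap
  have hr2 : ∀ i, (Finset.univ.filter fun v => r v = i).card ≤ 2 := by
    intro i
    induction i with
    | _ a b =>
    refine (Finset.card_le_card (t := {a, b}) fun v hv => ?_).trans Finset.card_le_two
    have := Sym2.eq_iff.1 (Finset.mem_filter.1 hv).2
    simp only [Finset.mem_insert, Finset.mem_singleton]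
    tauto
  let sd : (Sym2 V → Bool) → V → Bool := fun σ v => (η v == σ (r v))
  have hsd : ∀ σ v, boolSign (sd σ v) = boolSign (η v) * boolSign (σ (r v)) := by
    intro σ v
    simp only [sd]
    cases η v <;> cases σ (r v) <;> simp [boolSign]
  let c : V → Sym2 V → ℝ := fun v i => ∑ u with r u = i, q v u * boolSign (η u)
  have hc : ∀ σ v, ∑ u, q v u * boolSign (sd σ u) = ∑ i, c v i * boolSign (σ i) := by
    intro σ v
    rw [← Finset.sum_fiberwise Finset.univ r]
    refine Finset.sum_congr rfl fun i _ => ?_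
    rw [Finset.sum_mul]
    refine Finset.sum_congr rfl fun u hu => ?_
    rw [hsd, (Finset.mem_filter.1 hu).2, mul_assoc]
  have hcabs : ∀ v i, |c v i| ≤ ∑ u with r u = i, q v u := by
    intro v i
    refine (Finset.abs_sum_le_sum_abs _ _).trans (Finset.sum_le_sum fun u _ => ?_)
    rw [abs_mul, abs_boolSign, mul_one, abs_of_nonneg (hq0 v u)]
  -- A coin governs at most two vertices, so each coefficient is at most `2 * W`, while the
  -- coefficients sum to at most `D` in absolute value.
  have hc2 : ∀ v, ∑ i, c v i ^ 2 ≤ 2 * W * D := by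
    intro v
    calc ∑ i, c v i ^ 2 ≤ ∑ i, 2 * W * ∑ u with r u = i, q v u := by
          refine Finset.sum_le_sum fun i _ => ?_
          rw [← sq_abs, sq]
          refine mul_le_mul ((hcabs v i).trans ?_) (hcabs v i) (abs_nonneg _) (by positivity)
          refine (Finset.sum_le_card_nsmul _ _ W fun u _ => hqW v u).trans ?_
          rw [nsmul_eq_mul]
          have : ((Finset.univ.filter fun v => r v = i).card : ℝ) ≤ 2 := by
            exact_mod_cast hr2 i
          gcongr
      _ = 2 * W * ∑ u, q v u := by
          rw [← Finset.mul_sum, Finset.sum_fiberwise]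
      _ ≤ 2 * W * D := by
          have := hqD v
          gcongr
  set p := 2 * Real.exp (-(t ^ 2 / (4 * W * D))) with hp
  let hi : Finset V := Finset.univ.filter fun v => t ≤ ∑ u, q v u
  let bad : (Sym2 V → Bool) → Finset V := fun σ =>
    Finset.univ.filter fun v => t ≤ |∑ u, q v u * boolSign (sd σ u)|
  -- A vertex of degree below `t` is never bad, so the expected number of bad vertices scales with
  -- `hi.card` rather than with the size of `V`.
  have hbad : ∀ σ, bad σ ⊆ hi := by
    intro σ v hv
    refine Finset.mem_filter.2 ⟨Finset.mem_univ _, (Finset.mem_filter.1 hv).2.trans ?_⟩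
    refine (Finset.abs_sum_le_sum_abs _ _).trans (Finset.sum_le_sum fun u _ => ?_)
    rw [abs_mul, abs_boolSign, mul_one, abs_of_nonneg (hq0 v u)]
  have havg : ∑ σ, ((bad σ).card : ℝ) ≤ ∑ _σ : Sym2 V → Bool, (hi.card : ℝ) * p := by
    have h1 : ∀ σ, ((bad σ).card : ℝ) = ∑ v ∈ hi, if v ∈ bad σ then 1 else 0 := by
      intro σ
      rw [Finset.sum_boole, Finset.filter_mem_eq_inter, Finset.inter_eq_right.2 (hbad σ)]
    simp only [h1]
    rw [Finset.sum_comm, Finset.sum_const, nsmul_eq_mul, Finset.card_univ]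
    have h2 : ∀ v ∈ hi, ∑ σ, (if v ∈ bad σ then (1 : ℝ) else 0)
        ≤ Fintype.card (Sym2 V → Bool) * p := by
      intro v _
      rw [Finset.sum_boole]
      have := card_abs_signs_le (c v) (2 * W * D) t (by positivity) ht.le (hc2 v)
      rw [hp, show 4 * W * D = 2 * (2 * W * D) by ring]
      simpa only [bad, Finset.mem_filter, Finset.mem_univ, true_and, hc] using this
    refine (Finset.sum_le_card_nsmul _ _ _ h2).trans (le_of_eq ?_)
    rw [nsmul_eq_mul]
    ring
  obtain ⟨σ, -, hσ⟩ := Finset.exists_le_of_sum_le Finset.univ_nonempty havg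
  refine ⟨sd σ, ?_, ?_⟩
  · intro v hv
    simp only [sd, hr, hη v hv]
    cases η v <;> cases σ (r v) <;> simp
  · exact hσ

end Bipartition

/-! ### Surplus against cover -/

section DeficiencyBound

variable {V : Type*} [Fintype V]

/-- The pointwise estimate behind `deficiency_le`: it bounds the mass `e` sent from a set of
vertices with surpluses `α` to a vertex of cover value `y`. -/
theorem mass_le_of_surplus {ι : Type*} (D : Finset ι) (q α : ι → ℝ) (a y W θ : ℝ) (hyW : y ≤ W)
    (hq : ∀ u ∈ D, 0 ≤ q u) (hα : ∀ u ∈ D, 0 < α u) (ha : ∑ u ∈ D, q u ≤ a)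
    (h : ∀ u ∈ D, 0 < q u → a + α u ≤ y) (hpos : 0 < ∑ u ∈ D, q u) :
    (∑ u ∈ D, q u * α u) / W + (2 * θ - 1) * ∑ u ∈ D, q u ≤ θ ^ 2 * y := by
  set e := ∑ u ∈ D, q u with he
  set R := ∑ u ∈ D, q u * α u with hR
  have hR0 : 0 ≤ R := Finset.sum_nonneg fun u hu => mul_nonneg (hq u hu) (hα u hu).le
  have h1 : e * a + R ≤ e * y := by
    rw [he, hR, Finset.sum_mul, Finset.sum_mul, ← Finset.sum_add_distrib]
    refine Finset.sum_le_sum fun u hu => ?_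
    rcases (hq u hu).eq_or_lt with h0 | h0
    · simp [← h0]
    · have := mul_le_mul_of_nonneg_left (h u hu h0) h0.le
      linarith
  have h2 : e * e + R ≤ e * y := by
    have := mul_le_mul_of_nonneg_left ha hpos.le
    linarith
  have hy : 0 < y := by
    by_contra hy
    nlinarith
  have h3 : R / W ≤ R / y := div_le_div_of_nonneg_left hR0 hy hyW
  have h4 : R / y ≤ e - e * e / y := by
    rw [le_sub_iff_add_le, ← add_div, div_le_iff₀ hy]
    linarith
  -- This is `(e - θ y)² ≥ 0` divided by `y`: the concave `e - e² / y` is replaced by a bound linear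
  -- in `e` and `y`, which can be summed over vertices.
  have h5 : 2 * θ * e - θ ^ 2 * y ≤ e * e / y := by
    rw [le_div_iff₀ hy]
    nlinarith [sq_nonneg (e - θ * y)]
  linarith

/-- Let `a` be the degrees of a nonnegative symmetric weighting `q` such that `a` is dominated by
the cover `y` along the support of `q`. If `B` is a union of pairs `{v, μ v}` along which `a`
essentially exceeds `y` by `d ≥ 1`, then the total of `d` over the pairs is essentially at most
`(1 - 1 / (2 * W)) * ∑ v, y v`. -/
theorem deficiency_le (q : V → V → ℝ) (hq0 : ∀ u v, 0 ≤ q u v) (hqs : ∀ u v, q u v = q v u)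
    (a y : V → ℝ) (ha : ∀ v, a v = ∑ u, q v u) (W : ℝ) (hW : 1 ≤ W)
    (hy0 : ∀ v, 0 ≤ y v) (hyW : ∀ v, y v ≤ W)
    (hup : ∀ u v, 0 < q u v → a u + a v ≤ y u + y v)
    (μ : V → V) (hμ : ∀ v, μ (μ v) = v) (B : Finset V) (hB : ∀ v ∈ B, μ v ∈ B)
    (d : V → ℝ) (hd : ∀ v ∈ B, 1 ≤ d v) (δ : ℝ) (hδ0 : 0 ≤ δ) (hδ1 : δ ≤ 1)
    (hlow : ∀ v ∈ B, (1 - δ) * d v ≤ (a v - y v) + (a (μ v) - y (μ v))) :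
    (1 - δ) ^ 2 * ((∑ v ∈ B, d v) / 2) ≤ (1 - 1 / (2 * W)) * ∑ v, y v := by
  classical
  set D := B.filter fun v => y v < a v with hD
  set α : V → ℝ := fun v => a v - y v with hα
  set Δ := (∑ v ∈ B, d v) / 2 with hΔ
  set θ := 1 - 1 / (2 * W) with hθ
  set s := ∑ v ∈ D, α v with hs
  have hαD : ∀ v ∈ D, 0 < α v := fun v hv => sub_pos.2 (Finset.mem_filter.1 hv).2
  have hW0 : 0 < W := by linarith
  have hθ2 : 1 / 2 ≤ θ := by
    have : 1 / (2 * W) ≤ 1 / 2 := by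
      rw [div_le_div_iff₀ (by positivity) (by norm_num)]
      linarith
    linarith
  have hs0 : 0 ≤ s := Finset.sum_nonneg fun v hv => (hαD v hv).le
  have hΔs : (1 - δ) * Δ ≤ s := by
    have h1 : ∑ v ∈ B, α (μ v) = ∑ v ∈ B, α v :=
      Finset.sum_bij' (fun v _ => μ v) (fun v _ => μ v) hB hB (fun v _ => hμ v)
        (fun v _ => hμ v) fun v _ => rfl
    have h2 : ∑ v ∈ B, (1 - δ) * d v ≤ ∑ v ∈ B, (α v + α (μ v)) := Finset.sum_le_sum hlow
    rw [← Finset.mul_sum, Finset.sum_add_distrib, h1] at h2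
    have h3 : ∑ v ∈ B, α v ≤ s := by
      rw [hs, hD, Finset.sum_filter]
      refine Finset.sum_le_sum fun v _ => ?_
      split_ifs with h
      · exact le_rfl
      · exact sub_nonpos.2 (not_lt.1 h)
    rw [hΔ]
    linarith
  -- Here `1 ≤ d` enters; Cauchy–Schwarz then turns it into a lower bound on `∑ α²` that is linear
  -- in `s`.
  have hcard : (D.card : ℝ) ≤ 2 * Δ := by
    have h1 : (D.card : ℝ) ≤ B.card := by exact_mod_cast Finset.card_filter_le _ _
    have h2 := Finset.card_nsmul_le_sum B d 1 hd
    rw [nsmul_eq_mul, mul_one] at h2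
    rw [hΔ]
    linarith
  have hsq : s ^ 2 ≤ 2 * Δ * ∑ v ∈ D, α v ^ 2 :=
    (sq_sum_le_card_mul_sum_sq (s := D) (f := α)).trans
      (mul_le_mul_of_nonneg_right hcard (Finset.sum_nonneg fun v _ => sq_nonneg _))
  have hα2 : (1 - δ) * s / 2 ≤ ∑ v ∈ D, α v ^ 2 := by
    have hnn : 0 ≤ ∑ v ∈ D, α v ^ 2 := Finset.sum_nonneg fun v _ => sq_nonneg _
    rcases hs0.eq_or_lt with h | h
    · rw [← h]; simpa using hnn
    · have hΔ0 : 0 < Δ := by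
        by_contra hcon
        nlinarith
      have : (1 - δ) * Δ * s ≤ s * s := mul_le_mul_of_nonneg_right hΔs hs0
      by_contra! hcon
      nlinarith
  have hpt : ∀ z, (∑ u ∈ D, q z u * α u) / W + (2 * θ - 1) * ∑ u ∈ D, q z u
      ≤ θ ^ 2 * if z ∈ D then 0 else y z := by
    intro z
    have hnn : 0 ≤ ∑ u ∈ D, q z u := Finset.sum_nonneg fun u _ => hq0 z u
    rcases hnn.eq_or_lt with h | h
    · have h0 : ∀ u ∈ D, q z u = 0 := (Finset.sum_eq_zero_iff_of_nonneg fun u _ => hq0 z u).1 h.symm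
      have h1 : ∑ u ∈ D, q z u * α u = 0 := Finset.sum_eq_zero fun u hu => by rw [h0 u hu, zero_mul]
      rw [← h, h1]
      have : 0 ≤ if z ∈ D then 0 else y z := by
        split_ifs
        · exact le_rfl
        · exact hy0 z
      have := mul_nonneg (sq_nonneg θ) this
      simpa using this
    · have hle : ∀ u ∈ D, 0 < q z u → a z + α u ≤ y z := by
        intro u _ hu
        have := hup z u hu
        simp only [hα]
        linarith
      -- A vertex receiving mass from `D` has `a z < y z`, so no surplus of its own.
      have hz : z ∉ D := by
        obtain ⟨u, hu, hu0⟩ : ∃ u ∈ D, 0 < q z u := by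
          by_contra! hcon
          exact (Finset.sum_nonpos hcon).not_gt h
        have h1 := hle u hu hu0
        have h2 := hαD u hu
        intro hz
        have h3 := (Finset.mem_filter.1 hz).2
        linarith
      rw [if_neg hz]
      refine mass_le_of_surplus D (q z) α (a z) (y z) W θ (hyW z) (fun u _ => hq0 z u) hαD ?_ hle h
      rw [ha z]
      exact Finset.sum_le_sum_of_subset_of_nonneg (Finset.subset_univ _) fun u _ _ => hq0 z u
  have hsum := Finset.sum_le_sum fun z (_ : z ∈ Finset.univ) => hpt z
  rw [Finset.sum_add_distrib, ← Finset.sum_div, ← Finset.mul_sum, ← Finset.mul_sum,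
    Finset.sum_comm, Finset.sum_comm (f := fun z u => q z u)] at hsum
  have hcol : ∀ u, ∑ z, q z u = a u := fun u => by
    rw [ha u]
    exact Finset.sum_congr rfl fun z _ => hqs z u
  simp only [← Finset.sum_mul, hcol] at hsum
  set P := ∑ u ∈ D, y u with hP
  have hP0 : 0 ≤ P := Finset.sum_nonneg fun u _ => hy0 u
  have h1 : ∑ u ∈ D, a u = s + P := by
    rw [hs, hP, ← Finset.sum_add_distrib]
    exact Finset.sum_congr rfl fun u _ => by simp [hα]
  have h2 : ∑ z, (if z ∈ D then 0 else y z) ≤ ∑ z, y z := by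
    refine Finset.sum_le_sum fun z _ => ?_
    split_ifs
    · exact hy0 z
    · exact le_rfl
  have h3 : ∑ v ∈ D, α v ^ 2 ≤ ∑ v ∈ D, a v * α v := by
    refine Finset.sum_le_sum fun v hv => ?_
    have := mul_nonneg (hy0 v) (hαD v hv).le
    have h : a v = α v + y v := by simp [hα]
    rw [h]
    nlinarith
  -- The value of `θ` is chosen so that `1 - θ = 1 / (2 * W)`. The coefficients `1 - θ` and `2 * θ -
  -- 1` of `s` then add up to `θ`, and one factor `θ` cancels.
  have h4 : (1 - δ) * (1 - θ) * s ≤ (∑ v ∈ D, a v * α v) / W := by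
    rw [le_div_iff₀ hW0]
    have : (1 - θ) * W = 1 / 2 := by
      rw [hθ]
      field_simp
      ring
    calc (1 - δ) * (1 - θ) * s * W = (1 - δ) * s * ((1 - θ) * W) := by ring
      _ ≤ _ := by rw [this]; linarith
  rw [h1] at hsum
  have h5 : θ ^ 2 * ∑ z, (if z ∈ D then 0 else y z) ≤ θ ^ 2 * ∑ z, y z :=
    mul_le_mul_of_nonneg_left h2 (sq_nonneg θ)
  have h6 : 0 ≤ (2 * θ - 1) * P := mul_nonneg (by linarith) hP0
  have h7 : 0 ≤ δ * s * (2 * θ - 1) := mul_nonneg (mul_nonneg hδ0 hs0) (by linarith)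
  have h8 : θ * ((1 - δ) * s) ≤ θ * (θ * ∑ z, y z) := by nlinarith
  have h9 := le_of_mul_le_mul_left h8 (by linarith)
  have h10 : (1 - δ) * ((1 - δ) * Δ) ≤ (1 - δ) * s :=
    mul_le_mul_of_nonneg_left hΔs (by linarith)
  nlinarith

end DeficiencyBound

/-! ### Matchings, covers and total degree -/

section Matchings

variable {V : Type*} [Fintype V] {G : SimpleGraph V}

/-- Egerváry's theorem for a bipartite graph inside a subgraph `H`. -/
theorem exists_isMatching_totalWeight_eq_cover (H : G.Subgraph) (K : SimpleGraph V)
    (hK : ∀ u v, K.Adj u v → H.Adj u v) (side : V → Bool)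
    (hside : ∀ u v, K.Adj u v → side u ≠ side v) (w : Sym2 V → ℕ) (W : ℕ)
    (hW : ∀ u v, G.Adj u v → w s(u, v) ≤ W) :
    ∃ (M : G.Subgraph) (y : V → ℕ), M ≤ H ∧ M.IsMatching ∧
      totalWeight w M = ∑ v, y v ∧ (∀ u v, K.Adj u v → w s(u, v) ≤ y u + y v) ∧
      ∀ v, y v ≤ W := by
  classical
  obtain ⟨y, R, hcov, hsymm, huniq, htight, hsat⟩ :=
    exists_cover_and_tight_matching K side hside w
  let M : G.Subgraph :=
    { verts := {v | ∃ u, R v u}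
      Adj := R
      adj_sub := fun h => (hK _ _ (htight _ _ h).1).adj_sub
      edge_vert := fun h => ⟨_, h⟩
      symm := ⟨fun u v h => hsymm u v h⟩ }
  refine ⟨M, y, ⟨?_, ?_⟩, ?_, ?_, hcov, ?_⟩
  · rintro v ⟨u, hu⟩
    exact H.edge_vert (hK _ _ (htight _ _ hu).1)
  · exact fun u v h => hK _ _ (htight _ _ h).1
  · rintro v ⟨u, hu⟩
    exact ⟨u, hu, fun u' hu' => huniq v u' u hu' hu⟩
  · have h1 := sum_wdeg w M
    have h2 : ∀ v, ∑ u with R v u, y v = y v := by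
      intro v
      rcases Nat.eq_zero_or_pos (y v) with h | h
      · simp [h]
      · obtain ⟨u, hu⟩ := hsat v h
        have : Finset.univ.filter (R v) = {u} := by
          ext u'
          simp only [Finset.mem_filter, Finset.mem_univ, true_and, Finset.mem_singleton]
          exact ⟨fun h => huniq v u' u h hu, fun h => h ▸ hu⟩
        rw [this, Finset.sum_singleton]
    have h3 : ∑ v, wdeg w M v = ∑ v, y v + ∑ v, y v := by
      calc ∑ v, wdeg w M v = ∑ v, ∑ u with R v u, (y v + y u) := by
            refine Finset.sum_congr rfl fun v _ => ?_
            unfold wdeg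
            refine Finset.sum_congr (by ext; simp [M]) fun u hu => ?_
            exact (htight v u (Finset.mem_filter.1 hu).2).2
        _ = ∑ v, ∑ u with R v u, y v + ∑ v, ∑ u with R v u, y u := by
            simp only [Finset.sum_add_distrib]
        _ = ∑ v, ∑ u with R v u, y v + ∑ u, ∑ v with R u v, y u := by
            congr 1
            simp only [Finset.sum_filter]
            rw [Finset.sum_comm]
            refine Finset.sum_congr rfl fun u _ => Finset.sum_congr rfl fun v _ => ?_
            exact if_congr ⟨hsymm _ _, hsymm _ _⟩ rfl rfl
        _ = _ := by simp only [h2]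
    omega
  · intro v
    rcases Nat.eq_zero_or_pos (y v) with h | h
    · omega
    · obtain ⟨u, hu⟩ := hsat v h
      have h1 := htight v u hu
      have h2 := hW v u (hK _ _ h1.1).adj_sub
      omega

theorem wdeg_eq_of_isMatching (w : Sym2 V → ℕ) {M : G.Subgraph} (hM : M.IsMatching) {u v : V}
    (h : M.Adj v u) : wdeg w M v = w s(v, u) := by
  classical
  unfold wdeg
  have : Finset.univ.filter (M.Adj v) = {u} := by
    ext u'
    simp only [Finset.mem_filter, Finset.mem_univ, true_and, Finset.mem_singleton]
    exact ⟨fun h' => hM.eq_of_adj_left h' h, fun h' => h' ▸ h⟩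
  convert Finset.sum_singleton (fun u => w s(v, u)) u

theorem wdeg_eq_zero (w : Sym2 V → ℕ) {M : G.Subgraph} {v : V}
    (h : ∀ u, ¬ M.Adj v u) : wdeg w M v = 0 := by
  classical
  unfold wdeg
  exact Finset.sum_eq_zero fun u hu => absurd (Finset.mem_filter.1 hu).2 (h u)

/-- A maximum weight matching for positive weights meets every edge. -/
theorem IsMaxWeightMatching.exists_adj (w : Sym2 V → ℕ) (hw : ∀ e ∈ G.edgeSet, 1 ≤ w e)
    {M : G.Subgraph} (hM : IsMaxWeightMatching w ⊤ M) {u v : V} (huv : G.Adj u v) :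
    (∃ x, M.Adj u x) ∨ ∃ x, M.Adj v x := by
  classical
  by_contra! hcon
  have hdis : Disjoint M.support (G.subgraphOfAdj huv).support := by
    rw [Set.disjoint_left]
    rintro x ⟨z, hz⟩ ⟨z', hz'⟩
    change (G.subgraphOfAdj huv).Adj x z' at hz'
    rw [SimpleGraph.subgraphOfAdj_adj, Sym2.eq_iff] at hz'
    rcases hz' with ⟨rfl, -⟩ | ⟨-, rfl⟩
    · exact hcon.1 z hz
    · exact hcon.2 z hz
  have h1 := hM.max _ le_top
    (hM.isMatching.sup (SimpleGraph.Subgraph.IsMatching.subgraphOfAdj huv) hdis)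
  have h2 : totalWeight w M + w s(u, v)
      ≤ totalWeight w (M ⊔ G.subgraphOfAdj huv) := by
    unfold totalWeight
    have hn : s(u, v) ∉ Finset.univ.filter (· ∈ M.edgeSet) := by
      simpa using hcon.1 v
    rw [add_comm, ← Finset.sum_insert hn]
    refine Finset.sum_le_sum_of_subset fun e he => ?_
    rcases Finset.mem_insert.1 he with rfl | he
    · simp
    · simp [(Finset.mem_filter.1 he).2]
  have h3 := hw _ ((SimpleGraph.mem_edgeSet G).2 huv)
  omega

/-- The total weighted degree of a subgraph is controlled by its maximum weighted degree and a
maximum weight matching of the whole graph. -/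
theorem sum_wdeg_le (w : Sym2 V → ℕ) (hw : ∀ e ∈ G.edgeSet, 1 ≤ w e) (H : G.Subgraph) (D : ℕ)
    (hD : ∀ v, wdeg w H v ≤ D) {M : G.Subgraph} (hM : IsMaxWeightMatching w ⊤ M) :
    ∑ v, wdeg w H v ≤ 4 * D * totalWeight w M := by
  classical
  let p : V → ℕ := wdeg w M
  have hp : ∀ v, (∃ x, M.Adj v x) → 1 ≤ p v := by
    rintro v ⟨x, hx⟩
    simp only [p, wdeg_eq_of_isMatching w hM.isMatching hx]
    exact hw _ ((SimpleGraph.mem_edgeSet G).2 hx.adj_sub)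
  have hwd : ∀ v, wdeg w H v = ∑ u, if H.Adj v u then w s(v, u) else 0 := by
    intro v
    unfold wdeg
    rw [Finset.sum_filter]
  calc ∑ v, wdeg w H v = ∑ v, ∑ u, if H.Adj v u then w s(v, u) else 0 := by simp only [hwd]
    -- Every edge has an end matched by `M`, where `p ≥ 1`, so its weight can be charged to that
    -- end.
    _ ≤ ∑ v, ∑ u, (p v * (if H.Adj v u then w s(v, u) else 0)
          + p u * (if H.Adj v u then w s(v, u) else 0)) := by
        refine Finset.sum_le_sum fun v _ => Finset.sum_le_sum fun u _ => ?_
        split_ifs with h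
        · rw [← add_mul]
          refine Nat.le_mul_of_pos_left _ ?_
          rcases hM.exists_adj w hw h.adj_sub with h' | h'
          · have := hp v h'; omega
          · have := hp u h'; omega
        · simp
    _ = ∑ v, p v * wdeg w H v + ∑ v, p v * wdeg w H v := by
        simp only [Finset.sum_add_distrib]
        congr 1
        · simp only [hwd, Finset.mul_sum]
        · rw [Finset.sum_comm]
          simp only [hwd, Finset.mul_sum]
          refine Finset.sum_congr rfl fun v _ => Finset.sum_congr rfl fun u _ => ?_
          rw [Sym2.eq_swap]
          exact congrArg _ (if_congr ⟨fun h => h.symm, fun h => h.symm⟩ rfl rfl)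
    _ ≤ ∑ v, p v * D + ∑ v, p v * D := by
        have : ∑ v, p v * wdeg w H v ≤ ∑ v, p v * D :=
          Finset.sum_le_sum fun v _ => Nat.mul_le_mul_left _ (hD v)
        omega
    _ = _ := by
        rw [← Finset.sum_mul, sum_wdeg]
        ring

end Matchings

/-! ### Halving the degrees of `H` -/

section BipartiteSubgraph

variable {V : Type*} [Fintype V] {G : SimpleGraph V}

/-- The vertices of a matching are exchanged by an involution which fixes all other vertices. -/
theorem exists_partner {M : G.Subgraph} (hM : M.IsMatching) :
    ∃ μ : V → V, (∀ v, μ (μ v) = v) ∧ (∀ u v, M.Adj u v → μ u = v) ∧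
      ∀ v, M.Adj v (μ v) ∨ ∀ u, ¬ M.Adj v u := by
  classical
  let μ : V → V := fun v => if h : ∃ u, M.Adj v u then h.choose else v
  have h1 : ∀ u v, M.Adj u v → μ u = v := by
    intro u v h
    have h' : ∃ u', M.Adj u u' := ⟨v, h⟩
    simp only [μ, h', dite_true]
    exact hM.eq_of_adj_left h'.choose_spec h
  refine ⟨μ, fun v => ?_, h1, fun v => ?_⟩
  · by_cases h : ∃ u, M.Adj v u
    · obtain ⟨u, hu⟩ := h
      rw [h1 v u hu, h1 u v hu.symm]
    · have : μ v = v := by simp only [μ, h, dite_false]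
      rw [this, this]
  · by_cases h : ∃ u, M.Adj v u
    · obtain ⟨u, hu⟩ := h
      left
      rwa [h1 v u hu]
    · right
      exact not_exists.1 h

open Classical in
theorem wdeg_eq_sum_ite (w : Sym2 V → ℕ) (H : G.Subgraph) (v : V) :
    (wdeg w H v : ℝ) = ∑ u, if H.Adj v u then (w s(v, u) : ℝ) else 0 := by
  unfold wdeg
  rw [Finset.sum_filter]
  push_cast
  rfl

/-- Every subgraph `H` has a bipartite part `K` which contains the edges of `H` in a given matching
`M` and halves all weighted degrees approximately, apart from a small exceptional set `Z`. -/
theorem exists_bipartite_halving (w : Sym2 V → ℕ) (hw : ∀ e ∈ G.edgeSet, 1 ≤ w e) (W : ℕ)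
    (hW : 1 ≤ W) (hwW : ∀ e ∈ G.edgeSet, w e ≤ W) (H : G.Subgraph) {M : G.Subgraph}
    (hM : M.IsMatching) (D t X : ℝ) (hD : 0 < D) (ht : 0 < t) (hHD : ∀ v, (wdeg w H v : ℝ) ≤ D)
    (hX : ∑ v, (wdeg w H v : ℝ) ≤ X) :
    ∃ (K : SimpleGraph V) (side : V → Bool) (Z : Finset V) (κ : V → V → ℝ),
      (∀ u v, K.Adj u v → H.Adj u v) ∧ (∀ u v, K.Adj u v → side u ≠ side v) ∧
      (∀ u v, K.Adj u v → κ u v = w s(u, v)) ∧ (∀ u v, ¬ K.Adj u v → κ u v = 0) ∧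
      (∀ u v, K.Adj u v → ∑ x, κ u x ≤ (wdeg w H u + t) / 2) ∧
      (∀ v, v ∉ Z → (wdeg w H v - t) / 2 ≤ ∑ x, κ v x) ∧
      (∀ u v, M.Adj u v → u ∉ Z → v ∉ Z → H.Adj u v → K.Adj u v) ∧
      (Z.card : ℝ) ≤ (1 + D) * (X / t * (2 * Real.exp (-(t ^ 2 / (4 * W * D))))) := by
  classical
  obtain ⟨μ, hμ, hμM, -⟩ := exists_partner hM
  let q : V → V → ℝ := fun v u => if H.Adj v u then (w s(v, u) : ℝ) else 0
  have hqx : ∀ v, ∑ u, q v u = wdeg w H v := fun v => (wdeg_eq_sum_ite w H v).symm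
  have hq0 : ∀ u v, 0 ≤ q u v := by
    intro u v
    simp only [q]
    split_ifs <;> positivity
  have hqW : ∀ u v, q u v ≤ W := by
    intro u v
    simp only [q]
    split_ifs with h
    · exact_mod_cast hwW _ ((SimpleGraph.mem_edgeSet G).2 h.adj_sub)
    · positivity
  obtain ⟨side, hside, hbal⟩ := exists_balanced_sides q W D t (by exact_mod_cast hW) hD ht hq0 hqW
    (fun v => by rw [hqx]; exact hHD v) μ hμ
  let F : Finset V := Finset.univ.filter fun v => t ≤ |∑ u, q v u * boolSign (side u)|
  let N : V → Finset V := fun v => insert v (Finset.univ.filter (H.Adj v))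
  -- `K` omits all edges at the unbalanced set `F`, so upper degree bounds hold on all of its edges.
  -- Lower bounds can fail at `F` and its `H`-neighbours, which is why `Z` contains both.
  let Z : Finset V := F.biUnion N
  have hFZ : ∀ v, v ∉ Z → v ∉ F := fun v hv h =>
    hv (Finset.mem_biUnion.2 ⟨v, h, Finset.mem_insert_self _ _⟩)
  let K : SimpleGraph V :=
    { Adj := fun u v => H.Adj u v ∧ side u ≠ side v ∧ u ∉ F ∧ v ∉ F
      symm := ⟨fun u v h => ⟨h.1.symm, h.2.1.symm, h.2.2.2, h.2.2.1⟩⟩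
      loopless := ⟨fun u h => h.2.1 rfl⟩ }
  let κ : V → V → ℝ := fun u v => if K.Adj u v then (w s(u, v) : ℝ) else 0
  let cross : V → ℝ := fun v => ∑ u, if side v ≠ side u then q v u else 0
  have hcross : ∀ v, v ∉ F → (wdeg w H v - t) / 2 ≤ cross v ∧ cross v ≤ (wdeg w H v + t) / 2 := by
    intro v hv
    have h1 : |∑ u, q v u * boolSign (side u)| < t := by
      by_contra! h
      exact hv (Finset.mem_filter.2 ⟨Finset.mem_univ _, h⟩)
    have h2 : 2 * cross v = wdeg w H v - boolSign (side v) * ∑ u, q v u * boolSign (side u) := by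
      rw [← hqx, Finset.mul_sum, Finset.mul_sum, ← Finset.sum_sub_distrib]
      refine Finset.sum_congr rfl fun u _ => ?_
      cases side v <;> cases side u <;> simp [boolSign] <;> ring
    have h3 : |boolSign (side v) * ∑ u, q v u * boolSign (side u)| < t := by
      rwa [abs_mul, abs_boolSign, one_mul]
    rw [abs_lt] at h3
    constructor <;> linarith [h3.1, h3.2]
  refine ⟨K, side, Z, κ, fun u v h => h.1, fun u v h => h.2.1, fun u v h => if_pos h,
    fun u v h => if_neg h, ?_, ?_, ?_, ?_⟩
  · intro u v huv
    refine le_trans (Finset.sum_le_sum fun x _ => ?_) (hcross u huv.2.2.1).2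
    by_cases h : K.Adj u x
    · rw [if_pos h.2.1]
      simp only [κ, q, if_pos h, if_pos h.1, le_refl]
    · simp only [κ, if_neg h]
      split_ifs
      · exact hq0 u x
      · exact le_rfl
  · intro v hv
    refine (hcross v (hFZ v hv)).1.trans (Finset.sum_le_sum fun x _ => ?_)
    by_cases h : side v ≠ side x
    · rw [if_pos h]
      by_cases hH : H.Adj v x
      · have hx : x ∉ F := fun hx => hv (Finset.mem_biUnion.2
          ⟨x, hx, Finset.mem_insert_of_mem (Finset.mem_filter.2 ⟨Finset.mem_univ _, hH.symm⟩)⟩)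
        have hK : K.Adj v x := ⟨hH, h, hFZ v hv, hx⟩
        simp only [κ, q, if_pos hK, if_pos hH, le_refl]
      · have hK : ¬ K.Adj v x := fun h => hH h.1
        simp only [κ, q, if_neg hK, if_neg hH, le_refl]
    · rw [if_neg h]
      simp only [κ]
      split_ifs <;> positivity
  · intro u v huv hu hv hH
    refine ⟨hH, ?_, hFZ u hu, hFZ v hv⟩
    have h := hμM u v huv
    have := hside u (by rw [h]; exact huv.ne.symm)
    rw [h] at this
    exact this.symm
  · have hN : ∀ v ∈ F, ((N v).card : ℝ) ≤ 1 + D := by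
      intro v _
      have h1 : ((N v).card : ℝ) ≤ (Finset.univ.filter (H.Adj v)).card + 1 := by
        exact_mod_cast Finset.card_insert_le _ _
      have h2 : ((Finset.univ.filter (H.Adj v)).card : ℝ) ≤ wdeg w H v := by
        rw [Finset.card_eq_sum_ones]
        unfold wdeg
        push_cast
        refine le_of_le_of_eq (Finset.sum_le_sum fun u hu => ?_)
          (Finset.sum_congr (by ext; simp) fun _ _ => rfl)
        exact_mod_cast hw _ ((SimpleGraph.mem_edgeSet G).2 (Finset.mem_filter.1 hu).2.adj_sub)
      linarith [hHD v]
    have h1 : (Z.card : ℝ) ≤ F.card * (1 + D) := by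
      have : (Z.card : ℝ) ≤ ∑ v ∈ F, ((N v).card : ℝ) := by
        exact_mod_cast Finset.card_biUnion_le
      refine this.trans ((Finset.sum_le_card_nsmul _ _ _ hN).trans ?_)
      rw [nsmul_eq_mul]
    have h2 : ((Finset.univ.filter fun v => t ≤ ∑ u, q v u).card : ℝ) ≤ X / t := by
      rw [le_div_iff₀ ht, ← nsmul_eq_mul]
      refine (Finset.card_nsmul_le_sum _ (fun v => ∑ u, q v u) t
        fun v hv => (Finset.mem_filter.1 hv).2).trans (le_trans ?_ hX)
      simp only [hqx]
      exact Finset.sum_le_sum_of_subset_of_nonneg (Finset.filter_subset _ _)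
        fun _ _ _ => Nat.cast_nonneg _
    have h3 : (F.card : ℝ) ≤ X / t * (2 * Real.exp (-(t ^ 2 / (4 * W * D)))) :=
      hbal.trans (mul_le_mul_of_nonneg_right h2 (by positivity))
    calc (Z.card : ℝ) ≤ F.card * (1 + D) := h1
      _ ≤ _ := by
        rw [mul_comm]
        exact mul_le_mul_of_nonneg_left h3 (by linarith)

end BipartiteSubgraph

/-! ### From approximate degrees to the matching bound -/

section Assembly

variable {V : Type*} [Fintype V] {G : SimpleGraph V}

/-- The weight of a matching is at most the size of `y`, plus the deficiency of `y` on the matching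
edges avoiding `Z`, plus the weight lost on `Z`. -/
theorem two_mul_totalWeight_le (w : Sym2 V → ℕ) (W : ℕ) (hwW : ∀ e ∈ G.edgeSet, w e ≤ W)
    {M : G.Subgraph} (hM : M.IsMatching) (μ : V → V) (hμ : ∀ v, μ (μ v) = v)
    (hμM : ∀ v, M.Adj v (μ v) ∨ ∀ u, ¬ M.Adj v u) (Z B : Finset V) (y d : V → ℝ)
    (hy : ∀ v, 0 ≤ y v) (hd : ∀ v ∈ B, w s(v, μ v) ≤ y v + y (μ v) + d v)
    (hd0 : ∀ v ∈ B, 0 ≤ d v)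
    (hB : ∀ v, M.Adj v (μ v) → v ∉ Z → μ v ∉ Z → v ∉ B → w s(v, μ v) ≤ y v + y (μ v)) :
    2 * (totalWeight w M : ℝ) ≤ 2 * ∑ v, y v + ∑ v ∈ B, d v + 2 * W * Z.card := by
  classical
  let z : V → ℝ := fun v => if v ∈ Z then (W : ℝ) else 0
  let d' : V → ℝ := fun v => if v ∈ B then d v else 0
  have hz0 : ∀ v, 0 ≤ z v := fun v => by
    simp only [z]
    split_ifs <;> positivity
  have hd'0 : ∀ v, 0 ≤ d' v := fun v => by
    simp only [d']
    split_ifs with h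
    · exact hd0 v h
    · exact le_rfl
  have hpt : ∀ v, (wdeg w M v : ℝ) ≤ (y v + y (μ v)) + d' v + (z v + z (μ v)) := by
    intro v
    have h1 := hy v
    have h2 := hy (μ v)
    have h3 := hz0 v
    have h4 := hz0 (μ v)
    have h5 := hd'0 v
    rcases hμM v with h | h
    · rw [wdeg_eq_of_isMatching w hM h]
      have hwv : (w s(v, μ v) : ℝ) ≤ W := by
        exact_mod_cast hwW _ ((SimpleGraph.mem_edgeSet G).2 h.adj_sub)
      by_cases hv : v ∈ Z
      · have : z v = W := if_pos hv
        linarith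
      by_cases hv' : μ v ∈ Z
      · have : z (μ v) = W := if_pos hv'
        linarith
      by_cases hvB : v ∈ B
      · have : d' v = d v := if_pos hvB
        linarith [hd v hvB]
      · linarith [hB v h hv hv' hvB]
    · rw [wdeg_eq_zero w h]
      push_cast
      linarith
  have hcomp : ∀ f : V → ℝ, ∑ v, f (μ v) = ∑ v, f v := fun f =>
    Equiv.sum_comp (Function.Involutive.toPerm μ hμ) f
  have hsum := Finset.sum_le_sum fun v (_ : v ∈ Finset.univ) => hpt v
  simp only [Finset.sum_add_distrib, hcomp] at hsum
  have h1 : ∑ v, (wdeg w M v : ℝ) = 2 * totalWeight w M := by exact_mod_cast sum_wdeg w M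
  have h2 : ∑ v, d' v = ∑ v ∈ B, d v := by simp [d']
  have h3 : ∑ v, z v = W * Z.card := by simp [z, mul_comm]
  rw [h1, h2, h3] at hsum
  linarith

/-- The approximate degree constraints of a bipartite subgraph with degrees `κ` yield the matching
bound, up to the weight lost on an exceptional set `Z`. -/
theorem exists_matching_of_approx_degrees (w : Sym2 V → ℕ) (W : ℕ) (hW : 1 ≤ W)
    (hwW : ∀ e ∈ G.edgeSet, w e ≤ W) (H : G.Subgraph) {M : G.Subgraph}
    (hM : M.IsMatching) (K : SimpleGraph V) (side : V → Bool) (Z : Finset V) (κ : V → V → ℝ)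
    (hKH : ∀ u v, K.Adj u v → H.Adj u v) (hside : ∀ u v, K.Adj u v → side u ≠ side v)
    (hκ : ∀ u v, K.Adj u v → κ u v = w s(u, v)) (hκ0 : ∀ u v, ¬ K.Adj u v → κ u v = 0)
    (b η : ℝ) (hb : 0 < b) (hη0 : 0 ≤ η) (hη1 : η * W ≤ 1)
    (hup : ∀ u v, K.Adj u v → ∑ x, κ u x + ∑ x, κ v x ≤ b * w s(u, v))
    (hlow : ∀ u v, M.Adj u v → u ∉ Z → v ∉ Z → ¬ K.Adj u v →
      (1 - η) * b * w s(u, v) ≤ ∑ x, κ u x + ∑ x, κ v x) :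
    ∃ N : G.Subgraph, N ≤ H ∧ N.IsMatching ∧
      (1 - η * W) ^ 2 * ((totalWeight w M : ℝ) - W * Z.card)
        ≤ (1 - 1 / (2 * (W : ℝ)) + (1 - η * W) ^ 2) * totalWeight w N := by
  classical
  obtain ⟨μ, hμ, hμM, hμ'⟩ := exists_partner hM
  obtain ⟨N, y, hNH, hN, hNy, hcov, hyW⟩ := exists_isMatching_totalWeight_eq_cover H K hKH side
    hside w W fun u v h => hwW _ ((SimpleGraph.mem_edgeSet G).2 h)
  refine ⟨N, hNH, hN, ?_⟩
  -- The ends of the `M`-edges off `Z` that `y` fails to cover. Each such edge is counted at both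
  -- ends, whence the halved sums of `d`.
  let B : Finset V := Finset.univ.filter fun v =>
    M.Adj v (μ v) ∧ v ∉ Z ∧ μ v ∉ Z ∧ y v + y (μ v) < w s(v, μ v)
  let d : V → ℝ := fun v => w s(v, μ v) - y v - y (μ v)
  have hBmem : ∀ v ∈ B, M.Adj v (μ v) ∧ v ∉ Z ∧ μ v ∉ Z ∧ y v + y (μ v) < w s(v, μ v) :=
    fun v hv => (Finset.mem_filter.1 hv).2
  have hd1 : ∀ v ∈ B, 1 ≤ d v := by
    intro v hv
    have h : ((y v + y (μ v) + 1 : ℕ) : ℝ) ≤ w s(v, μ v) := by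
      exact_mod_cast (hBmem v hv).2.2.2
    push_cast at h
    simp only [d]
    linarith
  have hBμ : ∀ v ∈ B, μ v ∈ B := by
    intro v hv
    obtain ⟨h1, h2, h3, h4⟩ := hBmem v hv
    refine Finset.mem_filter.2 ⟨Finset.mem_univ _, ?_⟩
    rw [hμ]
    refine ⟨h1.symm, h3, h2, ?_⟩
    rw [Sym2.eq_swap, add_comm]
    exact h4
  have hκnn : ∀ u v, 0 ≤ κ u v := by
    intro u v
    by_cases h : K.Adj u v
    · rw [hκ u v h]; positivity
    · rw [hκ0 u v h]
  have hκs : ∀ u v, κ u v = κ v u := by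
    intro u v
    by_cases h : K.Adj u v
    · rw [hκ u v h, hκ v u h.symm, Sym2.eq_swap]
    · rw [hκ0 u v h, hκ0 v u fun h' => h h'.symm]
  have hW' : (1 : ℝ) ≤ W := by exact_mod_cast hW
  have hdef := deficiency_le (fun u v => κ u v / b) (fun u v => div_nonneg (hκnn u v) hb.le)
    (fun u v => by simp only [hκs u v]) (fun v => (∑ u, κ v u) / b) (fun v => (y v : ℝ))
    (fun v => Finset.sum_div _ _ _) W hW' (fun v => Nat.cast_nonneg _)
    (fun v => by exact_mod_cast hyW v) ?_ μ hμ B hBμ d hd1 (η * W) (by positivity) hη1 ?_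
  · have h2 := two_mul_totalWeight_le w W hwW hM μ hμ hμ' Z B (fun v => (y v : ℝ)) d
      (fun v => Nat.cast_nonneg _) (fun v _ => by simp only [d]; linarith)
      (fun v hv => by linarith [hd1 v hv]) ?_
    · have h3 : (totalWeight w N : ℝ) = ∑ v, (y v : ℝ) := by exact_mod_cast hNy
      rw [h3]
      have h4 : (totalWeight w M : ℝ) - W * Z.card ≤ ∑ v, (y v : ℝ) + (∑ v ∈ B, d v) / 2 := by
        linarith
      have h5 := mul_le_mul_of_nonneg_left h4 (sq_nonneg (1 - η * W))
      linarith
    · intro v hv h1 h2 h3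
      by_contra! hcon
      exact h3 (Finset.mem_filter.2 ⟨Finset.mem_univ _, hv, h1, h2, by exact_mod_cast hcon⟩)
  · intro u v huv
    have hK : K.Adj u v := by
      by_contra h
      simp [hκ0 u v h] at huv
    have h1 : (w s(u, v) : ℝ) ≤ y u + y v := by exact_mod_cast hcov u v hK
    have h2 := hup u v hK
    rw [← add_div, div_le_iff₀ hb]
    nlinarith
  · intro v hv
    obtain ⟨h1, h2, h3, h4⟩ := hBmem v hv
    have hK : ¬ K.Adj v (μ v) := fun h => absurd (hcov v (μ v) h) (not_le.2 h4)
    have h5 : (1 - η) * w s(v, μ v) ≤ (∑ u, κ v u) / b + (∑ u, κ (μ v) u) / b := by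
      rw [← add_div, le_div_iff₀ hb]
      linarith [hlow v (μ v) h1 h2 h3 hK]
    have h6 : (w s(v, μ v) : ℝ) ≤ W := by
      exact_mod_cast hwW _ ((SimpleGraph.mem_edgeSet G).2 h1.adj_sub)
    -- The error `η w` is relative to the weight; as `d v ≥ 1`, it is at most the fraction `η * W`
    -- of the deficiency.
    have h7 : (w s(v, μ v) : ℝ) ≤ W * d v := by
      have := mul_le_mul_of_nonneg_left (hd1 v hv) (by linarith : (0 : ℝ) ≤ W)
      linarith
    have h8 := mul_le_mul_of_nonneg_left h7 hη0
    simp only [d] at h8 ⊢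
    linarith

end Assembly

/-! ### Numerical estimates -/

section Numerics

/-- With maximum degree `W * β` and deviation `2 * lam * β`, the Hoeffding exponent is `β lam² / W²
≥ 2 log β`. The resulting factor `1 / β²` absorbs both the neighbourhood size and the degree sum. -/
theorem exceptional_weight_le (ε W lam β m : ℝ) (hε₀ : 0 < ε) (hW : 1 ≤ W)
    (hlam : lam = ε / (100 * W)) (hβ : 3 ≤ β) (hm : 0 ≤ m)
    (hlog : 2 * W ^ 2 * (lam ^ 2)⁻¹ ≤ β / Real.log β) :
    W * ((1 + W * β) * (4 * (W * β) * m / (2 * lam * β) *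
      (2 * Real.exp (-((2 * lam * β) ^ 2 / (4 * W * (W * β))))))) ≤ ε / 25 * m := by
  have hl0 : 0 < lam := by rw [hlam]; positivity
  have hlog1 : 1 ≤ Real.log β := by
    rw [Real.le_log_iff_exp_le (by linarith)]
    linarith [Real.exp_one_lt_d9]
  have h1 : 2 * W ^ 2 * Real.log β ≤ β * lam ^ 2 := by
    rw [le_div_iff₀ (by linarith)] at hlog
    have := mul_le_mul_of_nonneg_right hlog (sq_nonneg lam)
    calc 2 * W ^ 2 * Real.log β = 2 * W ^ 2 * (lam ^ 2)⁻¹ * Real.log β * lam ^ 2 := by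
          field_simp
      _ ≤ _ := this
  have h2 : Real.exp (-((2 * lam * β) ^ 2 / (4 * W * (W * β)))) ≤ 1 / β ^ 2 := by
    have h3 : (2 * lam * β) ^ 2 / (4 * W * (W * β)) = β * lam ^ 2 / W ^ 2 := by
      field_simp
      ring
    have h4 : 2 * Real.log β ≤ β * lam ^ 2 / W ^ 2 := by
      rw [le_div_iff₀ (by positivity)]
      linarith
    calc _ ≤ Real.exp (-(2 * Real.log β)) := by
          rw [h3, Real.exp_le_exp]
          linarith
      _ = 1 / β ^ 2 := by
          rw [Real.exp_neg, mul_comm, Real.exp_mul, Real.exp_log (by linarith), one_div]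
          norm_cast
  have h5 : 2 * W ^ 2 ≤ β * lam ^ 2 := by nlinarith [sq_nonneg W]
  have h6 : 1 + W * β ≤ 2 * (W * β) := by nlinarith
  calc W * ((1 + W * β) * (4 * (W * β) * m / (2 * lam * β) *
      (2 * Real.exp (-((2 * lam * β) ^ 2 / (4 * W * (W * β)))))))
      ≤ W * ((2 * (W * β)) * (4 * (W * β) * m / (2 * lam * β) * (2 * (1 / β ^ 2)))) := by
        gcongr
    _ = 4 * W * m * lam * ((2 * W ^ 2) / (β * lam ^ 2)) := by
        field_simp
    _ ≤ 4 * W * m * lam * 1 := by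
        have h7 : 2 * W ^ 2 / (β * lam ^ 2) ≤ 1 := by
          rw [div_le_one (by positivity)]
          exact h5
        gcongr
    _ = ε / 25 * m := by
        rw [hlam]
        field_simp
        ring

/-- The losses of about `18 ε / 100` and `4 ε / 100` total at most `22 ε / 100`; since `1 + θ + ε <
5 / 2`, the slack `ε` in the ratio pays for them. -/
theorem ratio_bound (ε θ m z T : ℝ) (hε₀ : 0 < ε) (hε₁ : ε < 1 / 2) (hθ1 : θ ≤ 1)
    (hm : 0 ≤ m) (hT : 0 ≤ T) (hz : z ≤ ε / 25 * m)
    (h : (1 - 9 * ε / 100) ^ 2 * (m - z) ≤ (θ + (1 - 9 * ε / 100) ^ 2) * T) :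
    m ≤ (1 + θ + ε) * T := by
  set c := (1 - 9 * ε / 100) ^ 2 with hc
  have hc1 : 1 - 18 * ε / 100 ≤ c := by rw [hc]; nlinarith
  have hc2 : c ≤ 1 := by rw [hc]; nlinarith
  have h1 : (1 - 22 * ε / 100) * m ≤ (1 + θ) * T := by
    have h2 : (1 - 18 * ε / 100) * ((1 - ε / 25) * m) ≤ c * (m - z) := by
      apply mul_le_mul hc1 (by linarith) _ (by linarith)
      exact mul_nonneg (by linarith) hm
    have h3 : (θ + c) * T ≤ (1 + θ) * T := mul_le_mul_of_nonneg_right (by linarith) hT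
    have h4 : (1 - 22 * ε / 100) * m ≤ (1 - 18 * ε / 100) * ((1 - ε / 25) * m) := by
      rw [← mul_assoc]
      exact mul_le_mul_of_nonneg_right (by nlinarith) hm
    linarith
  have h2 : (1 + θ) * T ≤ (1 - 22 * ε / 100) * ((1 + θ + ε) * T) := by
    rw [← mul_assoc]
    refine mul_le_mul_of_nonneg_right ?_ hT
    nlinarith
  exact le_of_mul_le_mul_left (h1.trans h2) (by linarith)

end Numerics

/-! ### Main theorem -/

section Main

variable {V : Type*} [Fintype V] {G : SimpleGraph V}

theorem IsWEDCS.wdeg_le {w : Sym2 V → ℕ} {β βm : ℤ} {H : G.Subgraph} (hH : IsWEDCS w β βm H)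
    {W : ℕ} (hwW : ∀ e ∈ G.edgeSet, w e ≤ W) (v : V) : (wdeg w H v : ℤ) ≤ W * β := by
  have hβ := hH.three_le
  by_cases h : ∃ u, H.Adj v u
  · obtain ⟨u, hu⟩ := h
    have h1 := hH.upper v u hu
    have h2 : (w s(v, u) : ℤ) ≤ W := by
      exact_mod_cast hwW _ ((SimpleGraph.mem_edgeSet G).2 hu.adj_sub)
    nlinarith
  · rw [wdeg_eq_zero w (not_exists.1 h)]
    push_cast
    positivity

end Main

theorem mainTheorem3 {V : Type*} [Fintype V] (G : SimpleGraph V)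
    (ε : ℝ) (hε₀ : 0 < ε) (hε₁ : ε < 1 / 2)
    (W : ℕ) (hW : 1 ≤ W)
    (w : Sym2 V → ℕ) (hw : ∀ e ∈ G.edgeSet, 1 ≤ w e ∧ w e ≤ W)
    (lam : ℝ) (hlam : lam = ε / (100 * (W : ℝ)))
    (β βm : ℤ) (hβ : βm + 2 ≤ β)
    (hlog : 2 * (W : ℝ) ^ 2 * (lam ^ 2)⁻¹ ≤ (β : ℝ) / Real.log (β : ℝ))
    (hβm : (1 - lam) * (β : ℝ) ≤ (βm : ℝ))
    (H : G.Subgraph) (hH : IsWEDCS w β βm H) :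
    ∃ MH : G.Subgraph, MH ≤ H ∧ MH.IsMatching ∧
      ∀ MG : G.Subgraph, IsMaxWeightMatching w ⊤ MG →
        (totalWeight w MG : ℝ) ≤ (2 - 1 / (2 * (W : ℝ)) + ε) * (totalWeight w MH : ℝ) := by
  -- The matching must not depend on `MG`, whereas the bipartition does; a maximum weight matching
  -- of `H` dominates every `N` found below.
  obtain ⟨MH, hMH⟩ := exists_isMaxWeightMatching w H
  refine ⟨MH, hMH.le, hMH.isMatching, fun MG hMG => ?_⟩
  have hw1 : ∀ e ∈ G.edgeSet, 1 ≤ w e := fun e he => (hw e he).1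
  have hwW : ∀ e ∈ G.edgeSet, w e ≤ W := fun e he => (hw e he).2
  have hW' : (1 : ℝ) ≤ W := by exact_mod_cast hW
  have hl0 : 0 < lam := by rw [hlam]; positivity
  have hlW : lam * W = ε / 100 := by rw [hlam]; field_simp
  have hl1 : lam ≤ 1 / 100 := by nlinarith
  have hβ3 : (3 : ℝ) ≤ β := by exact_mod_cast hH.three_le
  have hdeg : ∀ v, (wdeg w H v : ℝ) ≤ W * β := fun v => by exact_mod_cast hH.wdeg_le hwW v
  have hX : ∑ v, (wdeg w H v : ℝ) ≤ 4 * (W * β) * totalWeight w MG := by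
    obtain ⟨b, hb⟩ : ∃ b : ℕ, (b : ℤ) = β := ⟨β.toNat, Int.toNat_of_nonneg (by
      linarith [hH.three_le])⟩
    have hb' : (b : ℝ) = β := by exact_mod_cast congrArg (Int.cast (R := ℝ)) hb
    have := sum_wdeg_le w hw1 H (W * b) (fun v => by
      have := hH.wdeg_le hwW v
      rw [← hb] at this
      exact_mod_cast this) hMG
    rw [← hb']
    exact_mod_cast this
  obtain ⟨K, side, Z, κ, hKH, hside, hκ, hκ0, hκup, hκlow, hMK, hZ⟩ :=
    exists_bipartite_halving w hw1 W hW hwW H hMG.isMatching (W * β) (2 * lam * β) _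
      (by positivity) (by positivity) hdeg hX
  have hpos : ∀ u v, G.Adj u v → (1 : ℝ) ≤ w s(u, v) := fun u v h => by
    exact_mod_cast hw1 _ ((SimpleGraph.mem_edgeSet G).2 h)
  have hlb : 0 ≤ lam * β := by positivity
  -- Halving two degrees with deviation `2 * lam * β` costs `2 * lam * β` in total, absorbed into
  -- the factor `1 + 4 * lam` because weights are at least 1.
  have hup : ∀ u v, K.Adj u v →
      ∑ x, κ u x + ∑ x, κ v x ≤ (1 + 4 * lam) * β / 2 * w s(u, v) := by
    intro u v huv
    have h1 := hκup u v huv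
    have h2 := hκup v u huv.symm
    have h3 : (wdeg w H u : ℝ) + wdeg w H v ≤ β * w s(u, v) := by
      exact_mod_cast hH.upper u v (hKH u v huv)
    have h4 := mul_le_mul_of_nonneg_left (hpos u v (hKH u v huv).adj_sub) hlb
    linarith
  -- The constraint gives `(1 - 5 * lam) * β / 2` per unit of weight, and `(1 - 9 * lam) * (1 + 4 *
  -- lam) ≤ 1 - 5 * lam`.
  have hlow : ∀ u v, MG.Adj u v → u ∉ Z → v ∉ Z → ¬ K.Adj u v →
      (1 - 9 * lam) * ((1 + 4 * lam) * β / 2) * w s(u, v) ≤ ∑ x, κ u x + ∑ x, κ v x := by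
    intro u v huv hu hv hK
    have h1 := hκlow u hu
    have h2 := hκlow v hv
    have h3 : (βm : ℝ) * w s(u, v) ≤ wdeg w H u + wdeg w H v := by
      exact_mod_cast hH.lower u v huv.adj_sub fun h => hK (hMK u v huv hu hv h)
    have h4 := mul_le_mul_of_nonneg_left (hpos u v huv.adj_sub) hlb
    have h5 := mul_le_mul_of_nonneg_right hβm (Nat.cast_nonneg (w s(u, v)))
    have h6 : 0 ≤ lam * lam * β * w s(u, v) := by positivity
    linarith
  obtain ⟨N, hNH, hN, hbound⟩ := exists_matching_of_approx_degrees w W hW hwW H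
    hMG.isMatching K side Z κ hKH hside hκ hκ0 ((1 + 4 * lam) * β / 2) (9 * lam)
    (by positivity) (by positivity) (by linarith) hup hlow
  have h1 : (totalWeight w N : ℝ) ≤ totalWeight w MH := by exact_mod_cast hMH.max N hNH hN
  have hθ0 : 1 / (2 * (W : ℝ)) ≤ 1 := by
    rw [div_le_one (by positivity)]
    linarith
  have hθ1 : 0 ≤ 1 / (2 * (W : ℝ)) := by positivity
  have h2 := (mul_le_mul_of_nonneg_left hZ (by linarith : (0 : ℝ) ≤ W)).trans
    (exceptional_weight_le ε W lam β (totalWeight w MG) hε₀ hW' hlam hβ3 (Nat.cast_nonneg _)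
      hlog)
  have h3 : 9 * lam * W = 9 * ε / 100 := by linarith
  rw [h3] at hbound
  have h4 := ratio_bound ε (1 - 1 / (2 * (W : ℝ))) _ _ _ hε₀ hε₁ (by linarith)
    (Nat.cast_nonneg _) (Nat.cast_nonneg _) h2 hbound
  refine (h4.trans_eq (by ring)).trans (mul_le_mul_of_nonneg_left h1 ?_)
  linarith
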